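/- **Theorem.** For positive integers $s_1,\dots,s_d$ with $s_1\ge 2$ let $$\zeta(s_1,\dots,s_d)=\sum_{k_1>\cdots>k_d>0}\frac1{k_1^{s_1}\cdots k_d^{s_d}},\qquad G_d(x_1,\dots,x_d)=\sum_{s_1\ge2,\;s_2,\dots,s_d\ge1}x_1^{s_1-1}\cdots x_d^{s_d-1}\,\zeta(s_1,\dots,s_d).$$ Write $\bigoplus_{\mathcal S(x_1,x_2,x_3)}f(x_1,x_2,x_3)$ for the sum of $f$ over all six permutations of the arguments $x_1,x_2,x_3$, and $\bigoplus_{\mathcal C(x_1,x_2,x_3)}f=f(x_1,x_2,x_3)+f(x_2,x_3,x_1)+f(x_3,x_1,x_2)$, $\bigoplus_{\mathcal C(x_2,x_3)}f=f(x_2,x_3)+f(x_3,x_2)$ for the sums over cyclic permutations. Put $x_{ij}=x_i+x_j$ and $x_{123}=x_1+x_2+x_3$. The multiple zeta values of depth at most three above converge. The series $G_1(y_1)$ converges absolutely for $|y_1|<1$, $G_2(y_1,y_2)$ for $|y_1|<2$, $|y_2|<1$, and $G_3(y_1,y_2,y_3)$ for $|y_1|<3$, $|y_2|<2$, $|y_3|<1$.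 For all pairwise distinct non-zero complex numbers $x_1,x_2,x_3$ with $|x_i|<1$, all series below converge absolutely, and $$\begin{aligned} &\bigoplus_{\mathcal S(x_1,x_2,x_3)}\Big\{G_3(x_{123},x_{12},x_2)-G_3(x_{12},x_{12},x_2)-G_3(x_{23},x_2,x_2)+G_3(x_2,x_2,x_2)-G_3(x_1,x_2,x_3)\\ &\qquad\qquad-\frac{G_2(x_1,x_3)+G_2(x_3,x_1)}{x_3-x_2}+\frac{G_2(x_1,x_2)}{x_2}+\frac{G_2(x_2,x_1)}{x_2}\Big\}\\ &-\bigoplus_{\mathcal C(x_2,x_3)}\Big\{\frac1{x_3-x_2}\Big(\frac{G_1(x_3)-G_1(x_1)}{x_3-x_1}+\frac{G_1(x_2)}{x_2}\Big)-\frac{G_1(x_2)-G_1(x_1)}{x_2(x_2-x_1)}+\frac{G_1(x_1)}{x_1x_2}\Big\}\\ =\;&\bigoplus_{\mathcal S(x_1,x_2,x_3)}\Big\{\sum_{r_1\ge2,\,r_2\ge1}x_1^{r_2-1}\big[x_{13}^{r_1-1}-x_1^{r_1-1}-x_3^{r_1-1}\big]\zeta(r_1,r_2,1)+\sum_{s\ge2}x_1^{s-2}\zeta(s,1)\\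 &\qquad\qquad-\sum_{s_1\ge2,\,s_3\ge1}x_1^{s_1-1}x_3^{s_3-1}\zeta(s_1,1,s_3)+\frac1{x_2}\sum_{s\ge2}x_1^{s-1}\zeta(s,1)-\sum_{s\ge2}\frac{x_3^{s-1}}{x_3-x_2}\zeta(s,1)\Big\}\\ &+\bigoplus_{\mathcal C(x_1,x_2,x_3)}\Big\{\sum_{s\ge2}x_1^{s-1}\zeta(s,2)+\sum_{s\ge2}x_1^{s-1}\zeta(2,s)+\frac{G_1(x_1)}{x_1^2}-\frac{\zeta(2)}{x_1}\Big\}-\zeta(3). \end{aligned}$$ -/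

import Mathlib

noncomputable section

namespace MZV

/-- Admissible indices `(s_1, …, s_d)`: positive integers with `s_1 > 1`.
The entry `s_1` is `s 0` in Lean. -/
def IsAdmissible {d : ℕ} (s : Fin d → ℕ) : Prop :=
  (∀ i, 1 ≤ s i) ∧ ∀ i : Fin d, (i : ℕ) = 0 → 1 < s i

/-- The range of summation `k_1 > ⋯ > k_d > 0` of a multiple zeta value. -/
abbrev DecrIndex (d : ℕ) : Type :=
  {k : Fin d → ℕ // StrictAnti k ∧ ∀ i, 0 < k i}

/-- The summand `1 / (k_1 ^ s_1 ⋯ k_d ^ s_d)`. -/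
def zetaTerm {d : ℕ} (s : Fin d → ℕ) (k : DecrIndex d) : ℝ :=
  ∏ i, 1 / (k.1 i : ℝ) ^ s i

/-- The multiple zeta value `ζ(s_1, …, s_d)`. -/
def zeta {d : ℕ} (s : Fin d → ℕ) : ℝ :=
  ∑' k : DecrIndex d, zetaTerm s k

/-- The summand `x_1 ^ (s_1 - 1) ⋯ x_d ^ (s_d - 1) ζ(s_1, …, s_d)`. -/
def genTerm {d : ℕ} (x : Fin d → ℂ) (s : {s : Fin d → ℕ // IsAdmissible s}) : ℂ :=
  (∏ i, x i ^ (s.1 i - 1)) * (zeta s.1 : ℂ)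

/-- The generating function `G_d(x_1, …, x_d)` of the multiple zeta values of depth `d`. -/
def G {d : ℕ} (x : Fin d → ℂ) : ℂ :=
  ∑' s : {s : Fin d → ℕ // IsAdmissible s}, genTerm x s

/-- The integers `s ≥ 2`. -/
abbrev GeTwo : Type := {s : ℕ // 2 ≤ s}

/-- The pairs of integers `r_1 ≥ 2`, `r_2 ≥ 1`. -/
abbrev GeTwoOne : Type := {r : ℕ × ℕ // 2 ≤ r.1 ∧ 1 ≤ r.2}

/-- The sum of `f` over all permutations of its three arguments. -/
def symSum₃ (f : ℂ → ℂ → ℂ → ℂ) (x₁ x₂ x₃ : ℂ) : ℂ :=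
  f x₁ x₂ x₃ + f x₁ x₃ x₂ + f x₂ x₁ x₃ + f x₂ x₃ x₁ + f x₃ x₁ x₂ + f x₃ x₂ x₁

/-- The sum of `f` over the cyclic permutations of its three arguments. -/
def cycSum₃ (f : ℂ → ℂ → ℂ → ℂ) (x₁ x₂ x₃ : ℂ) : ℂ :=
  f x₁ x₂ x₃ + f x₂ x₃ x₁ + f x₃ x₁ x₂

/-- The sum of `f` over the cyclic permutations of its two arguments. -/
def cycSum₂ (f : ℂ → ℂ → ℂ) (x₁ x₂ : ℂ) : ℂ :=
  f x₁ x₂ + f x₂ x₁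

end MZV

end

/-! The product G(x₁)G(x₂)G(x₃) of depth-one series is evaluated in two ways, and the results are
equated.

Summing the geometric series over the exponents first turns G into a sum over k₁ > ⋯ > k_d of R(x₁,
k₁) ∏_{i ≥ 2} 1/(k_i - x_i), where R(x, n) = 1/(n - x) - 1/n (`hasSum_genKernel`). The correction
-1/n reflects s₁ ≥ 2. The interchange rests on absolute convergence of the double family over
indices and exponents (`summable_genFamily`). The product is then the sum of R(x₁, a) R(x₂, b) R(x₃,
c) over all positive a, b, c.

Harmonic product (`iterSum₁_mul_mul`, `G_mul_mul_harmonic`): the triples are split by order type.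
Where indices coincide, partial fractions in n make products of R's linear in the R's; the leftover
1/n² and 1/n³ produce ζ(s,2), ζ(2,s), ζ(2) and ζ(3).

Shuffle product (`regPole_mul_mul_eq`, `G_mul_mul_shuffle`): 1/(abc) is decomposed into six terms
such as 1/((a+b+c)(a+b)b), and the partial sums become the new decreasing indices. The shifts by x_i
add up along with the indices, whence the arguments x₁+x₂+x₃ and x₁+x₂.

The corrections -1/n appear as arguments equal to 0. Since 0^(s-1) is nonzero only for s = 1, these
terms are the series with an exponent fixed at 1. The terms G(x,0,0) arise on both sides and cancel.
-/

namespace MZV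

/-! ### Products of absolutely convergent series -/

theorem summable_and_hasSum_mul {𝕜 : Type*} [NormedField 𝕜] [CompleteSpace 𝕜] {α β : Type*}
    {f : α → 𝕜} {g : β → 𝕜} (hf : Summable (fun n => ‖f n‖)) (hg : Summable (fun n => ‖g n‖)) :
    Summable (fun p : α × β => ‖f p.1 * g p.2‖) ∧
      HasSum (fun p : α × β => f p.1 * g p.2) ((∑' n, f n) * ∑' n, g n) := by
  have h := hf.mul_norm hg
  exact ⟨h, hf.of_norm.hasSum.mul hg.of_norm.hasSum h.of_norm⟩

/-- A product of absolutely convergent series, as one series over tuples of indices. -/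
theorem summable_and_hasSum_pi_prod {𝕜 : Type*} [NormedField 𝕜] [CompleteSpace 𝕜] {d : ℕ} {f : Fin d → ℕ → 𝕜}
    (hf : ∀ i, Summable (fun n => ‖f i n‖)) :
    Summable (fun t : Fin d → ℕ => ‖∏ i, f i (t i)‖) ∧
      HasSum (fun t : Fin d → ℕ => ∏ i, f i (t i)) (∏ i, ∑' n, f i n) := by
  induction d with
  | zero =>
    refine ⟨Summable.of_finite, ?_⟩
    exact hasSum_unique _
  | succ d ih =>
    obtain ⟨h1, h2⟩ := ih (f := fun i => f i.succ) (fun i => hf i.succ)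
    obtain ⟨h3, h4⟩ := summable_and_hasSum_mul (hf 0) h1
    rw [h2.tsum_eq] at h4
    constructor
    · rw [← (Fin.consEquiv (fun _ : Fin (d + 1) => ℕ)).summable_iff]
      refine h3.congr fun p => ?_
      rw [Function.comp_apply, Fin.prod_univ_succ]
      rfl
    · rw [← (Fin.consEquiv (fun _ : Fin (d + 1) => ℕ)).hasSum_iff, Fin.prod_univ_succ]
      refine h4.congr_fun fun p => ?_
      rw [Function.comp_apply, Fin.prod_univ_succ]
      rfl

/-! ### Summation over the exponents -/

/-- The excess over `1` of the least admissible exponent in position `i`. -/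
def excess {d : ℕ} (i : Fin d) : ℕ := if (i : ℕ) = 0 then 1 else 0

/-- Admissible indices correspond to arbitrary tuples of natural numbers. -/
def admissibleEquiv (d : ℕ) : (Fin d → ℕ) ≃ {s : Fin d → ℕ // IsAdmissible s} where
  toFun t := ⟨fun i => t i + excess i + 1, fun i => Nat.le_add_left _ _, fun i hi => by simp [excess, hi]⟩
  invFun s i := s.1 i - 1 - excess i
  left_inv t := by ext i; simp
  right_inv s := by
    ext i
    have h1 := s.2.1 i
    have h2 := s.2.2 i
    simp only [excess]
    split_ifs with h
    · have := h2 h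
      omega
    · omega

theorem hasSum_geometric_excess {𝕜 : Type*} [RCLike 𝕜] {y : 𝕜} {k : ℕ} (hy : ‖y‖ < k) (e : ℕ) :
    Summable (fun t : ℕ => ‖y ^ (t + e) * (1 / (k : 𝕜) ^ (t + e + 1))‖) ∧
    HasSum (fun t : ℕ => y ^ (t + e) * (1 / (k : 𝕜) ^ (t + e + 1)))
      ((y / k) ^ e * (1 / (k - y))) := by
  have hk : (0 : ℝ) < k := lt_of_le_of_lt (norm_nonneg _) hy
  have hk0 : (k : 𝕜) ≠ 0 := by
    have : k ≠ 0 := by rintro rfl; simp at hk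
    exact_mod_cast this
  have hr : ‖y / k‖ < 1 := by
    rw [norm_div, RCLike.norm_natCast]
    exact (div_lt_one hk).2 hy
  have hky : (k : 𝕜) - y ≠ 0 := by
    intro h
    rw [sub_eq_zero] at h
    rw [← h, RCLike.norm_natCast] at hy
    exact lt_irrefl _ hy
  have key : ∀ t : ℕ, y ^ (t + e) * (1 / (k : 𝕜) ^ (t + e + 1))
      = ((y / k) ^ e * (1 / k)) * (y / k) ^ t := by
    intro t
    rw [pow_add, pow_succ, pow_add, div_pow, div_pow]
    field_simp
  simp only [key]
  constructor
  · simp only [norm_mul, norm_pow]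
    exact (summable_geometric_of_lt_one (norm_nonneg _) hr).mul_left _
  · have h := (hasSum_geometric_of_norm_lt_one hr).mul_left ((y / k) ^ e * (1 / k))
    have h1 : 1 / (k : 𝕜) * (1 - y / k)⁻¹ = 1 / (k - y) := by
      rw [one_sub_div hk0, inv_div]
      field_simp
    rwa [mul_assoc, h1] at h

/-- For a fixed `k`, the sum over all admissible exponents. -/
theorem hasSum_admissible {𝕜 : Type*} [RCLike 𝕜] {d : ℕ} {y : Fin d → 𝕜} {k : Fin d → ℕ}
    (hy : ∀ i, ‖y i‖ < k i) :
    Summable (fun s : {s : Fin d → ℕ // IsAdmissible s} =>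
      ‖∏ i, y i ^ (s.1 i - 1) * (1 / (k i : 𝕜) ^ s.1 i)‖) ∧
    HasSum (fun s : {s : Fin d → ℕ // IsAdmissible s} =>
      ∏ i, y i ^ (s.1 i - 1) * (1 / (k i : 𝕜) ^ s.1 i))
      (∏ i, (y i / k i) ^ excess i * (1 / (k i - y i))) := by
  have h := summable_and_hasSum_pi_prod
    (f := fun i t => y i ^ (t + excess i) * (1 / (k i : 𝕜) ^ (t + excess i + 1)))
    (fun i => (hasSum_geometric_excess (hy i) (excess i)).1)
  rw [← (admissibleEquiv d).summable_iff, ← (admissibleEquiv d).hasSum_iff]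
  refine ⟨h.1, ?_⟩
  have h2 := h.2
  simp only [fun i => (hasSum_geometric_excess (hy i) (excess i)).2.tsum_eq] at h2
  exact h2

/-! ### Absolute convergence over decreasing indices -/

/-- The last entry is at least 1 and each step to the left gains at least 1. This bound is the
source of the radii 3, 2, 1. -/
theorem DecrIndex.le_apply {d : ℕ} (k : DecrIndex d) (i : Fin d) : d - i ≤ k.1 i := by
  obtain ⟨k, hk, hp⟩ := k
  simp only
  induction d with
  | zero => exact i.elim0
  | succ d ih =>
    induction i using Fin.reverseInduction with
    | last => have := hp (Fin.last d); simp; omega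
    | cast i h =>
      have h3 : k i.succ < k i.castSucc := hk (Fin.castSucc_lt_succ)
      simp only [Fin.val_succ, Fin.val_castSucc] at h ⊢
      omega

/-- The extra factor 1/k₁ is shared equally among the n + 1 positions: as k₁ is the largest entry,
each share k₁^(-1/(n+1)) is at most k_i^(-1/(n+1)). The bound is a product of convergent
one-variable series, so the ordering of the k_i can then be dropped. -/
theorem prod_inv_excess_le {n : ℕ} (k : DecrIndex (n + 1)) :
    ∏ i, (1 / (k.1 i : ℝ)) ^ (1 + excess i)
      ≤ ∏ i, 1 / (k.1 i : ℝ) ^ (1 + 1 / ((n : ℝ) + 1)) := by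
  have hpos : ∀ i, (0 : ℝ) < k.1 i := fun i => by exact_mod_cast k.2.2 i
  have hn : (0 : ℝ) < (n : ℝ) + 1 := by positivity
  have h1 : ∏ i, (1 / (k.1 i : ℝ)) ^ (1 + excess i) = (1 / (k.1 0 : ℝ)) * ∏ i, 1 / (k.1 i : ℝ) := by
    simp only [pow_add, pow_one, Finset.prod_mul_distrib]
    rw [mul_comm]
    congr 1
    rw [Fin.prod_univ_succ]
    simp [excess]
  have h2 : ∏ i, 1 / (k.1 i : ℝ) ^ (1 + 1 / ((n : ℝ) + 1))
      = (∏ i, 1 / (k.1 i : ℝ) ^ (1 / ((n : ℝ) + 1))) * ∏ i, 1 / (k.1 i : ℝ) := by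
    rw [← Finset.prod_mul_distrib]
    refine Finset.prod_congr rfl fun i _ => ?_
    rw [Real.rpow_add (hpos i), Real.rpow_one]
    field_simp
  rw [h1, h2]
  refine mul_le_mul_of_nonneg_right ?_ (Finset.prod_nonneg fun i _ => by positivity)
  have h3 : (1 / (k.1 0 : ℝ)) = ∏ _i : Fin (n + 1), 1 / (k.1 0 : ℝ) ^ (1 / ((n : ℝ) + 1)) := by
    rw [Finset.prod_const, Finset.card_univ, Fintype.card_fin, div_pow, one_pow,
      ← Real.rpow_natCast, ← Real.rpow_mul (hpos 0).le]
    push_cast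
    rw [one_div_mul_cancel hn.ne', Real.rpow_one]
  rw [h3]
  refine Finset.prod_le_prod (fun i _ => by positivity) fun i _ => ?_
  refine one_div_le_one_div_of_le (Real.rpow_pos_of_pos (hpos i) _) ?_
  refine Real.rpow_le_rpow (hpos i).le ?_ (by positivity)
  exact_mod_cast k.2.1.antitone (Fin.zero_le i)

theorem summable_prod_inv_excess (n : ℕ) :
    Summable (fun k : DecrIndex (n + 1) => ∏ i, (1 / (k.1 i : ℝ)) ^ (1 + excess i)) := by
  have hn : (0 : ℝ) < (n : ℝ) + 1 := by positivity
  have h := (summable_and_hasSum_pi_prod (d := n + 1)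
    (f := fun _ k => 1 / (k : ℝ) ^ (1 + 1 / ((n : ℝ) + 1))) (fun _ =>
      ((Real.summable_one_div_nat_rpow).2 (by
        have : 0 < 1 / ((n : ℝ) + 1) := by positivity
        linarith)).norm)).2.summable
  refine Summable.of_nonneg_of_le (fun k => Finset.prod_nonneg fun i _ => by positivity)
    prod_inv_excess_le (h.comp_injective Subtype.val_injective)

theorem summable_zetaTerm {n : ℕ} {s : Fin (n + 1) → ℕ} (hs : IsAdmissible s) :
    Summable (zetaTerm s) := by
  refine Summable.of_nonneg_of_le (fun k => Finset.prod_nonneg fun i _ => by positivity)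
    (fun k => ?_) (summable_prod_inv_excess n)
  refine Finset.prod_le_prod (fun i _ => by positivity) fun i _ => ?_
  have hk : (1 : ℝ) ≤ k.1 i := by exact_mod_cast k.2.2 i
  rw [one_div_pow]
  refine one_div_le_one_div_of_le (by positivity) (pow_le_pow_right₀ hk ?_)
  have h1 := hs.1 i
  have h2 := hs.2 i
  simp only [excess]
  split_ifs with h
  · exact h2 h
  · exact h1

/-! ### The generating function as a sum of kernels -/

/-- The summand of `G` for the index `s`, before the sum over `k` is taken. -/
noncomputable def genFamily {d : ℕ} (y : Fin d → ℂ) (s : {s : Fin d → ℕ // IsAdmissible s})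
    (k : DecrIndex d) : ℂ :=
  ∏ i, y i ^ (s.1 i - 1) * (1 / (k.1 i : ℂ) ^ s.1 i)

/-- The sum of `genFamily` over all admissible indices. -/
noncomputable def genKernel {d : ℕ} (y : Fin d → ℂ) (k : DecrIndex d) : ℂ :=
  ∏ i, (y i / k.1 i) ^ excess i * (1 / (k.1 i - y i))

/-- With m = n + 1 - i ≤ k_i one has k_i - ‖y_i‖ ≥ (1 - ‖y_i‖/m) k_i, so the sum of norms over the
exponents is at most a constant times the convergent majorant in `summable_prod_inv_excess`. -/
theorem summable_genFamily {n : ℕ} {y : Fin (n + 1) → ℂ}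
    (hy : ∀ i : Fin (n + 1), ‖y i‖ < ((n + 1 - i : ℕ) : ℝ)) :
    Summable (fun p : DecrIndex (n + 1) × {s : Fin (n + 1) → ℕ // IsAdmissible s} =>
      genFamily y p.2 p.1) := by
  have hyk : ∀ (k : DecrIndex (n + 1)) i, ‖y i‖ < k.1 i := fun k i =>
    (hy i).trans_le (by exact_mod_cast k.le_apply i)
  apply Summable.of_norm
  refine (summable_prod_of_nonneg (fun p => norm_nonneg _)).2
    ⟨fun k => (hasSum_admissible (hyk k)).1, ?_⟩
  -- The norms form the same family over ℝ with y replaced by ‖y‖, so the closed form applies again.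
  have hval : ∀ k : DecrIndex (n + 1), ∑' s, ‖genFamily y s k‖
      = ∏ i, (‖y i‖ / k.1 i) ^ excess i * (1 / (k.1 i - ‖y i‖)) := by
    intro k
    rw [← (hasSum_admissible (𝕜 := ℝ) (y := fun i => ‖y i‖) (k := k.1)
      (fun i => by simpa using hyk k i)).2.tsum_eq]
    simp [genFamily, norm_prod]
  simp only [hval]
  have hm : ∀ i : Fin (n + 1), (0 : ℝ) < ((n + 1 - i : ℕ) : ℝ) := fun i =>
    (norm_nonneg _).trans_lt (hy i)
  refine Summable.of_nonneg_of_le (fun k => Finset.prod_nonneg fun i _ => ?_) (fun k => ?_)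
    ((summable_prod_inv_excess n).mul_left
      (∏ i : Fin (n + 1), ‖y i‖ ^ excess i * (1 / (1 - ‖y i‖ / ((n + 1 - i : ℕ) : ℝ)))))
  · have := hyk k i
    have : 0 < (k.1 i : ℝ) - ‖y i‖ := by linarith
    positivity
  · rw [← Finset.prod_mul_distrib]
    refine Finset.prod_le_prod (fun i _ => ?_) fun i _ => ?_
    · have := hyk k i
      have : 0 < (k.1 i : ℝ) - ‖y i‖ := by linarith
      positivity
    · have hk := hyk k i
      have hk0 : (0 : ℝ) < k.1 i := by exact_mod_cast k.2.2 i
      have hk1 : 0 < (k.1 i : ℝ) - ‖y i‖ := by linarith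
      have hr : 0 < 1 - ‖y i‖ / ((n + 1 - i : ℕ) : ℝ) :=
        sub_pos.2 ((div_lt_one (hm i)).2 (hy i))
      have hle : (1 - ‖y i‖ / ((n + 1 - i : ℕ) : ℝ)) * k.1 i ≤ k.1 i - ‖y i‖ := by
        have h1 : ((n + 1 - i : ℕ) : ℝ) ≤ k.1 i := by exact_mod_cast k.le_apply i
        have h2 : ‖y i‖ ≤ ‖y i‖ / ((n + 1 - i : ℕ) : ℝ) * k.1 i := by
          rw [div_mul_eq_mul_div, le_div_iff₀ (hm i)]
          exact mul_le_mul_of_nonneg_left h1 (norm_nonneg _)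
        linarith
      have h3 := one_div_le_one_div_of_le (mul_pos hr hk0) hle
      calc (‖y i‖ / k.1 i) ^ excess i * (1 / (k.1 i - ‖y i‖))
          ≤ (‖y i‖ / k.1 i) ^ excess i
            * (1 / ((1 - ‖y i‖ / ((n + 1 - i : ℕ) : ℝ)) * k.1 i)) := by gcongr
        _ = _ := by
          rw [pow_add, pow_one, div_pow, div_pow, one_pow]
          field_simp

theorem genTerm_eq_tsum {d : ℕ} (y : Fin d → ℂ) (s : {s : Fin d → ℕ // IsAdmissible s}) :
    genTerm y s = ∑' k, genFamily y s k := by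
  simp only [genTerm, zeta, genFamily, Finset.prod_mul_distrib, tsum_mul_left]
  congr 1
  rw [Complex.ofReal_tsum]
  simp [zetaTerm]

theorem summable_genTerm {n : ℕ} {y : Fin (n + 1) → ℂ}
    (hy : ∀ i : Fin (n + 1), ‖y i‖ < ((n + 1 - i : ℕ) : ℝ)) : Summable (genTerm y) := by
  have h := (summable_genFamily hy).prod_symm.prod
  refine h.congr fun s => ?_
  rw [genTerm_eq_tsum]
  rfl

/-- A part of the series `G` may be summed over `s` first. -/
theorem hasSum_genTerm_comp {n : ℕ} {y : Fin (n + 1) → ℂ}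
    (hy : ∀ i : Fin (n + 1), ‖y i‖ < ((n + 1 - i : ℕ) : ℝ)) {ι : Type*}
    {φ : ι → {s : Fin (n + 1) → ℕ // IsAdmissible s}} (hφ : Function.Injective φ) :
    Summable (fun k => ∑' i, genFamily y (φ i) k) ∧
      HasSum (fun i => genTerm y (φ i)) (∑' k, ∑' i, genFamily y (φ i) k) := by
  have h : Summable (fun p : DecrIndex (n + 1) × ι => genFamily y (φ p.2) p.1) :=
    ((summable_genFamily hy).comp_injective
      (i := fun p : DecrIndex (n + 1) × ι => (p.1, φ p.2)) (by
        rintro ⟨a, b⟩ ⟨c, d⟩ h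
        simp only [Prod.mk.injEq] at h
        rw [h.1, hφ h.2])).congr fun _ => rfl
  refine ⟨h.prod, ?_⟩
  have h2 := (summable_genTerm hy).comp_injective hφ
  have h3 : ∀ i, (genTerm y ∘ φ) i = ∑' k, genFamily y (φ i) k := fun i => genTerm_eq_tsum y (φ i)
  have h4 : ∑' k, ∑' i, genFamily y (φ i) k = ∑' i, (genTerm y ∘ φ) i := by
    rw [tsum_congr h3]
    exact Summable.tsum_comm (f := fun i k => genFamily y (φ i) k) h.prod_symm
  rw [h4]
  exact h2.hasSum

theorem hasSum_genKernel {n : ℕ} {y : Fin (n + 1) → ℂ}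
    (hy : ∀ i : Fin (n + 1), ‖y i‖ < ((n + 1 - i : ℕ) : ℝ)) :
    HasSum (genKernel y) (G y) := by
  have h := hasSum_genTerm_comp hy Function.injective_id
  have hk : ∀ k : DecrIndex (n + 1), ∑' s, genFamily y (id s) k = genKernel y k := fun k =>
    (hasSum_admissible (fun i => (hy i).trans_le (by exact_mod_cast k.le_apply i))).2.tsum_eq
  simp only [hk] at h
  have hG : G y = ∑' k, genKernel y k := h.2.tsum_eq
  rw [hG]
  exact h.1.hasSum

/-! ### Order types of triples of positive integers -/

/-- Turns a sum over one order type into a sum over all triples with an indicator, so that different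
order types can be added termwise. -/
theorem hasSum_ite_mem_range {α β : Type*} {F : β → ℂ} (hF : Summable F) {e : α → β}
    (he : Function.Injective e) {C : β → Prop} [DecidablePred C] (hC : ∀ p, C p ↔ p ∈ Set.range e) :
    HasSum (fun p => if C p then F p else 0) (∑' k, F (e k)) := by
  rw [← he.hasSum_iff (fun p hp => if_neg (fun h => hp ((hC p).1 h)))]
  refine HasSum.congr_fun (hF.comp_injective he).hasSum fun k => ?_
  simp [(hC (e k)).2 ⟨k, rfl⟩]

/-- Triples of positive integers. -/
abbrev PosTriple : Type := ℕ+ × ℕ+ × ℕ+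

/-- The rotation of a triple. -/
def PosTriple.rot : PosTriple ≃ PosTriple where
  toFun p := (p.2.1, p.2.2, p.1)
  invFun p := (p.2.2, p.1, p.2.1)
  left_inv _ := rfl
  right_inv _ := rfl

/-- The transposition of the first two entries of a triple. -/
def PosTriple.swap : PosTriple ≃ PosTriple where
  toFun p := (p.2.1, p.1, p.2.2)
  invFun p := (p.2.1, p.1, p.2.2)
  left_inv _ := rfl
  right_inv _ := rfl

/-- The entries of `k` as positive integers. -/
def DecrIndex.entry {d : ℕ} (k : DecrIndex d) (i : Fin d) : ℕ+ := ⟨k.1 i, k.2.2 i⟩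

theorem DecrIndex.ext_entry {d : ℕ} {k l : DecrIndex d} (h : ∀ i, k.entry i = l.entry i) :
    k = l :=
  Subtype.ext (funext fun i => congrArg PNat.val (h i))

theorem DecrIndex.entry_lt {d : ℕ} (k : DecrIndex d) {i j : Fin d} (h : i < j) :
    k.entry j < k.entry i := k.2.1 h

/-- A decreasing pair. -/
def DecrIndex.mk₂ (a b : ℕ+) (h : b < a) : DecrIndex 2 :=
  ⟨![a, b], by
    rw [Fin.strictAnti_iff_succ_lt]
    intro i
    fin_cases i
    simpa using h, by
    intro i
    fin_cases i
    · exact a.2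
    · exact b.2⟩

/-- A decreasing triple. -/
def DecrIndex.mk₃ (a b c : ℕ+) (h : b < a) (h' : c < b) : DecrIndex 3 :=
  ⟨![a, b, c], by
    rw [Fin.strictAnti_iff_succ_lt]
    intro i
    fin_cases i
    · simpa using h
    · simpa using h', by
    intro i
    fin_cases i
    · exact a.2
    · exact b.2
    · exact c.2⟩

/-- A single positive integer. -/
def DecrIndex.mk₁ (a : ℕ+) : DecrIndex 1 :=
  ⟨![a], Subsingleton.strictAnti _, fun i => by
    fin_cases i
    exact a.2⟩

/-- Indices of depth one are positive integers. -/
def DecrIndex.equivPNat : DecrIndex 1 ≃ ℕ+ where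
  toFun k := k.entry 0
  invFun := DecrIndex.mk₁
  left_inv k := DecrIndex.ext_entry fun i => by
    fin_cases i
    rfl
  right_inv _ := rfl

/-- Indices of depth three correspond to triples by taking partial sums. -/
def PosTriple.partialSums : PosTriple ≃ DecrIndex 3 where
  toFun p := DecrIndex.mk₃ (p.1 + p.2.1 + p.2.2) (p.1 + p.2.1) p.2.1
    (PNat.lt_add_right _ _) (PNat.lt_add_left _ _)
  invFun k := (k.entry 1 - k.entry 2, k.entry 2, k.entry 0 - k.entry 1)
  left_inv p := by
    obtain ⟨a, b, c⟩ := p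
    have h1 : a + b + c - (a + b) = c := by
      rw [add_comm, PNat.add_sub]
    have h2 : a + b - b = a := PNat.add_sub
    change (a + b - b, b, a + b + c - (a + b)) = _
    rw [h1, h2]
  right_inv k := by
    have h1 : k.entry 2 < k.entry 1 := k.entry_lt (by decide)
    have h2 : k.entry 1 < k.entry 0 := k.entry_lt (by decide)
    have h3 : k.entry 1 - k.entry 2 + k.entry 2 = k.entry 1 := by
      rw [add_comm, PNat.add_sub_of_lt h1]
    apply DecrIndex.ext_entry
    intro i
    fin_cases i
    · change k.entry 1 - k.entry 2 + k.entry 2 + (k.entry 0 - k.entry 1) = k.entry 0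
      rw [h3, PNat.add_sub_of_lt h2]
    · exact h3
    · rfl

/-- The permutation σ carries the standard ordering to any of the six strict ones. -/
theorem hasSum_ite_decreasing {F : PosTriple → ℂ} (hF : Summable F) (σ : PosTriple ≃ PosTriple) :
    HasSum (fun p => if (σ.symm p).2.1 < (σ.symm p).1 ∧ (σ.symm p).2.2 < (σ.symm p).2.1
      then F p else 0) (∑' k : DecrIndex 3, F (σ (k.entry 0, k.entry 1, k.entry 2))) := by
  refine hasSum_ite_mem_range hF (C := fun p => (σ.symm p).2.1 < (σ.symm p).1 ∧
    (σ.symm p).2.2 < (σ.symm p).2.1) ?_ fun p => ⟨fun h => ?_, ?_⟩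
  · refine σ.injective.comp fun k l h => DecrIndex.ext_entry fun i => ?_
    simp only [Prod.mk.injEq] at h
    fin_cases i
    exacts [h.1, h.2.1, h.2.2]
  · exact ⟨DecrIndex.mk₃ _ _ _ h.1 h.2, σ.apply_symm_apply p⟩
  · rintro ⟨k, rfl⟩
    rw [σ.symm_apply_apply]
    exact ⟨k.entry_lt (by decide), k.entry_lt (by decide)⟩

/-- Here and in `hasSum_ite_eq_snd` the three rotations suffice as σ, since exchanging the two equal
entries changes nothing. -/
theorem hasSum_ite_eq_fst {F : PosTriple → ℂ} (hF : Summable F) (σ : PosTriple ≃ PosTriple) :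
    HasSum (fun p => if (σ.symm p).2.1 = (σ.symm p).1 ∧ (σ.symm p).2.2 < (σ.symm p).2.1
      then F p else 0) (∑' k : DecrIndex 2, F (σ (k.entry 0, k.entry 0, k.entry 1))) := by
  refine hasSum_ite_mem_range hF (C := fun p => (σ.symm p).2.1 = (σ.symm p).1 ∧
    (σ.symm p).2.2 < (σ.symm p).2.1) ?_ fun p => ⟨fun h => ?_, ?_⟩
  · refine σ.injective.comp fun k l h => DecrIndex.ext_entry fun i => ?_
    simp only [Prod.mk.injEq] at h
    fin_cases i
    exacts [h.1, h.2.2]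
  · refine ⟨DecrIndex.mk₂ _ _ h.2, σ.eq_symm_apply.1 ?_⟩
    exact Prod.ext h.1 rfl
  · rintro ⟨k, rfl⟩
    rw [σ.symm_apply_apply]
    exact ⟨rfl, k.entry_lt (by decide)⟩

theorem hasSum_ite_eq_snd {F : PosTriple → ℂ} (hF : Summable F) (σ : PosTriple ≃ PosTriple) :
    HasSum (fun p => if (σ.symm p).2.1 < (σ.symm p).1 ∧ (σ.symm p).2.2 = (σ.symm p).2.1
      then F p else 0) (∑' k : DecrIndex 2, F (σ (k.entry 0, k.entry 1, k.entry 1))) := by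
  refine hasSum_ite_mem_range hF (C := fun p => (σ.symm p).2.1 < (σ.symm p).1 ∧
    (σ.symm p).2.2 = (σ.symm p).2.1) ?_ fun p => ⟨fun h => ?_, ?_⟩
  · refine σ.injective.comp fun k l h => DecrIndex.ext_entry fun i => ?_
    simp only [Prod.mk.injEq] at h
    fin_cases i
    exacts [h.1, h.2.1]
  · refine ⟨DecrIndex.mk₂ _ _ h.1, σ.eq_symm_apply.1 ?_⟩
    exact Prod.ext rfl (Prod.ext rfl h.2.symm)
  · rintro ⟨k, rfl⟩
    rw [σ.symm_apply_apply]
    exact ⟨k.entry_lt (by decide), rfl⟩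

theorem hasSum_ite_eq {F : PosTriple → ℂ} (hF : Summable F) :
    HasSum (fun p : PosTriple => if p.1 = p.2.1 ∧ p.2.1 = p.2.2 then F p else 0)
      (∑' k : DecrIndex 1, F (k.entry 0, k.entry 0, k.entry 0)) := by
  refine hasSum_ite_mem_range hF (C := fun p : PosTriple => p.1 = p.2.1 ∧ p.2.1 = p.2.2) ?_
    fun p => ⟨fun h => ?_, ?_⟩
  · intro k l h
    simp only [Prod.mk.injEq] at h
    refine DecrIndex.ext_entry fun i => ?_
    fin_cases i
    exact h.1
  · exact ⟨DecrIndex.mk₁ p.2.1, Prod.ext h.1.symm (Prod.ext rfl h.2)⟩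
  · rintro ⟨k, rfl⟩
    exact ⟨rfl, rfl⟩

/-! ### The harmonic product -/

/-- The iterated sum of depth one. -/
noncomputable def iterSum₁ (f : ℕ → ℂ) : ℂ := ∑' k : DecrIndex 1, f (k.1 0)

/-- The iterated sum of depth two. -/
noncomputable def iterSum₂ (f g : ℕ → ℂ) : ℂ := ∑' k : DecrIndex 2, f (k.1 0) * g (k.1 1)

/-- The iterated sum of depth three. -/
noncomputable def iterSum₃ (f g h : ℕ → ℂ) : ℂ :=
  ∑' k : DecrIndex 3, f (k.1 0) * g (k.1 1) * h (k.1 2)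

theorem summable_norm_pnat {f : ℕ → ℂ} (hf : Summable fun k : DecrIndex 1 => f (k.1 0)) :
    Summable fun n : ℕ+ => ‖f n‖ :=
  (DecrIndex.equivPNat.symm.summable_iff (f := fun k : DecrIndex 1 => ‖f (k.1 0)‖)).2 hf.norm

theorem iterSum₁_eq_tsum_pnat (f : ℕ → ℂ) : iterSum₁ f = ∑' n : ℕ+, f n :=
  (DecrIndex.equivPNat.symm.tsum_eq (fun k : DecrIndex 1 => f (k.1 0))).symm

theorem hasSum_posTriple {f g h : ℕ → ℂ} (hf : Summable fun k : DecrIndex 1 => f (k.1 0))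
    (hg : Summable fun k : DecrIndex 1 => g (k.1 0))
    (hh : Summable fun k : DecrIndex 1 => h (k.1 0)) :
    HasSum (fun p : PosTriple => f p.1 * (g p.2.1 * h p.2.2))
      (iterSum₁ f * (iterSum₁ g * iterSum₁ h)) := by
  simp only [iterSum₁_eq_tsum_pnat]
  have h1 := summable_and_hasSum_mul (summable_norm_pnat hg) (summable_norm_pnat hh)
  have h2 := summable_and_hasSum_mul (summable_norm_pnat hf) h1.1
  rw [h1.2.tsum_eq] at h2
  exact h2.2

/-- The harmonic product of three series. -/
theorem iterSum₁_mul_mul {f g h : ℕ → ℂ} (hf : Summable fun k : DecrIndex 1 => f (k.1 0))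
    (hg : Summable fun k : DecrIndex 1 => g (k.1 0))
    (hh : Summable fun k : DecrIndex 1 => h (k.1 0)) :
    iterSum₁ f * (iterSum₁ g * iterSum₁ h)
      = iterSum₃ f g h + iterSum₃ h f g + iterSum₃ g h f
        + iterSum₃ g f h + iterSum₃ h g f + iterSum₃ f h g
        + iterSum₂ (f * g) h + iterSum₂ (h * f) g + iterSum₂ (g * h) f
        + iterSum₂ f (g * h) + iterSum₂ h (f * g) + iterSum₂ g (h * f)
        + iterSum₁ (f * g * h) := by
  have hF := hasSum_posTriple hf hg hh
  have hs := hF.summable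
  -- Thirteen order types: six strict, three with the two largest equal, three with the two smallest
  -- equal, and one with all equal.
  have H := ((((((((((((hasSum_ite_decreasing hs (Equiv.refl _)).add
    (hasSum_ite_decreasing hs PosTriple.rot)).add
    (hasSum_ite_decreasing hs (PosTriple.rot.trans PosTriple.rot))).add
    (hasSum_ite_decreasing hs PosTriple.swap)).add
    (hasSum_ite_decreasing hs (PosTriple.rot.trans PosTriple.swap))).add
    (hasSum_ite_decreasing hs (PosTriple.swap.trans PosTriple.rot))).add
    (hasSum_ite_eq_fst hs (Equiv.refl _))).add
    (hasSum_ite_eq_fst hs PosTriple.rot)).add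
    (hasSum_ite_eq_fst hs (PosTriple.rot.trans PosTriple.rot))).add
    (hasSum_ite_eq_snd hs (Equiv.refl _))).add
    (hasSum_ite_eq_snd hs PosTriple.rot)).add
    (hasSum_ite_eq_snd hs (PosTriple.rot.trans PosTriple.rot))).add
    (hasSum_ite_eq hs)
  have hval := hF.unique (H.congr_fun fun p => ?_)
  · rw [hval]
    simp only [iterSum₃, iterSum₂, iterSum₁, Equiv.refl_apply, Equiv.trans_apply, PosTriple.rot,
      PosTriple.swap, Equiv.coe_fn_mk, DecrIndex.entry, PNat.mk_coe, Pi.mul_apply]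
    iterate 12 refine congrArg₂ (fun a b => a + b) ?_ ?_
    all_goals exact tsum_congr fun k => by ring
  · obtain ⟨a, b, c⟩ := p
    simp only [Equiv.refl_symm, Equiv.refl_apply, Equiv.symm_trans_apply, PosTriple.rot,
      PosTriple.swap, Equiv.coe_fn_symm_mk]
    generalize f a * (g b * h c) = t
    -- In every consistent case exactly one of the thirteen indicators holds.
    rcases lt_trichotomy a b with h1 | h1 | h1 <;> rcases lt_trichotomy b c with h2 | h2 | h2 <;>
      rcases lt_trichotomy a c with h3 | h3 | h3 <;>
      first
      | (exfalso; order)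
      | (first | subst h1 | skip
         first | subst h2 | skip
         simp [*, lt_asymm, ne_of_lt, ne_of_gt])

/-! ### Kernels in terms of simple poles -/

/-- The function `n ↦ 1 / (n - x)`. -/
noncomputable def pole (x : ℂ) (n : ℕ) : ℂ := 1 / (n - x)

/-- The function `n ↦ 1 / (n - x) - 1 / n`. -/
noncomputable def regPole (x : ℂ) (n : ℕ) : ℂ := 1 / (n - x) - 1 / n

theorem natCast_sub_ne_zero {x : ℂ} {n : ℕ} (h : ‖x‖ < n) : (n : ℂ) - x ≠ 0 := by
  intro h0
  rw [sub_eq_zero] at h0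
  rw [← h0, Complex.norm_natCast] at h
  exact lt_irrefl _ h

theorem regPole_eq {x : ℂ} {n : ℕ} (h : ‖x‖ < n) : x / n * (1 / (n - x)) = regPole x n := by
  have h1 := natCast_sub_ne_zero h
  have h2 : (n : ℂ) ≠ 0 := by
    have := (norm_nonneg x).trans_lt h
    exact_mod_cast this.ne'
  rw [regPole]
  field_simp
  ring

theorem hasSum_regPole {x : ℂ} (hx : ‖x‖ < 1) :
    HasSum (fun k : DecrIndex 1 => regPole x (k.1 0)) (G ![x]) := by
  refine (hasSum_genKernel (y := ![x]) (fun i => ?_)).congr_fun fun k => ?_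
  · fin_cases i
    simpa using hx
  · have h : ‖x‖ < k.1 0 := hx.trans_le (by exact_mod_cast k.2.2 0)
    simp [genKernel, excess, ← regPole_eq h]

theorem hasSum_regPole_pole {x y : ℂ} (hx : ‖x‖ < 2) (hy : ‖y‖ < 1) :
    HasSum (fun k : DecrIndex 2 => regPole x (k.1 0) * pole y (k.1 1)) (G ![x, y]) := by
  refine (hasSum_genKernel (y := ![x, y]) (fun i => ?_)).congr_fun fun k => ?_
  · fin_cases i
    · simpa using hx
    · simpa using hy
  · have h : ‖x‖ < k.1 0 := hx.trans_le (by exact_mod_cast k.le_apply 0)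
    simp [genKernel, excess, ← regPole_eq h, Fin.prod_univ_two, pole]

theorem hasSum_regPole_pole_pole {x y z : ℂ} (hx : ‖x‖ < 3) (hy : ‖y‖ < 2) (hz : ‖z‖ < 1) :
    HasSum (fun k : DecrIndex 3 => regPole x (k.1 0) * pole y (k.1 1) * pole z (k.1 2))
      (G ![x, y, z]) := by
  refine (hasSum_genKernel (y := ![x, y, z]) (fun i => ?_)).congr_fun fun k => ?_
  · fin_cases i
    · simpa using hx
    · simpa using hy
    · simpa using hz
  · have h : ‖x‖ < k.1 0 := hx.trans_le (by exact_mod_cast k.le_apply 0)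
    simp [genKernel, excess, ← regPole_eq h, Fin.prod_univ_three, pole]

/-! ### The shuffle product -/

/-- The partial fraction decomposition behind the shuffle product of three series. -/
theorem one_div_mul_mul_eq {a b c : ℂ} (ha : 0 < a.re) (hb : 0 < b.re) (hc : 0 < c.re) :
    1 / a * (1 / b * (1 / c)) =
      1 / (a + b + c) * (1 / (a + b)) * (1 / b) + 1 / (a + b + c) * (1 / (a + b)) * (1 / a)
      + 1 / (a + b + c) * (1 / (b + c)) * (1 / b) + 1 / (a + b + c) * (1 / (b + c)) * (1 / c)
      + 1 / (a + b + c) * (1 / (a + c)) * (1 / a) + 1 / (a + b + c) * (1 / (a + c)) * (1 / c) := by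
  have ne : ∀ z : ℂ, 0 < z.re → z ≠ 0 := fun z hz h => by simp [h] at hz
  have h1 := ne a ha
  have h2 := ne b hb
  have h3 := ne c hc
  have h4 := ne (a + b) (by rw [Complex.add_re]; linarith)
  have h5 := ne (b + c) (by rw [Complex.add_re]; linarith)
  have h6 := ne (a + c) (by rw [Complex.add_re]; linarith)
  have h7 := ne (a + b + c) (by simp only [Complex.add_re]; linarith)
  -- The two-variable decomposition is applied to each pair, after dividing 1/(ab) + 1/(bc) + 1/(ac)
  -- = (a+b+c)/(abc) by a+b+c.
  have e1 : 1 / (a + b) * (1 / b) + 1 / (a + b) * (1 / a) = 1 / a * (1 / b) := by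
    field_simp
  have e2 : 1 / (b + c) * (1 / b) + 1 / (b + c) * (1 / c) = 1 / b * (1 / c) := by
    field_simp
    ring
  have e3 : 1 / (a + c) * (1 / a) + 1 / (a + c) * (1 / c) = 1 / a * (1 / c) := by
    field_simp
    ring
  have e4 : 1 / (a + b + c) * (1 / a * (1 / b) + 1 / b * (1 / c) + 1 / a * (1 / c))
      = 1 / a * (1 / b * (1 / c)) := by
    field_simp
    ring
  rw [← e4, ← e1, ← e2, ← e3]
  ring

/-- The contribution of one ordering to the shuffle product. -/
noncomputable def shuffleKernel (x₁ x₂ x₃ : ℂ) (k : DecrIndex 3) : ℂ :=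
  regPole (x₁ + x₂ + x₃) (k.1 0) * pole (x₁ + x₂) (k.1 1) * pole x₂ (k.1 2)
  - regPole (x₁ + x₂) (k.1 0) * pole (x₁ + x₂) (k.1 1) * pole x₂ (k.1 2)
  - regPole (x₂ + x₃) (k.1 0) * pole x₂ (k.1 1) * pole x₂ (k.1 2)
  + regPole x₂ (k.1 0) * pole x₂ (k.1 1) * pole x₂ (k.1 2)
  - regPole (x₁ + x₃) (k.1 0) * pole x₁ (k.1 1) * pole 0 (k.1 2)
  + regPole x₁ (k.1 0) * pole x₁ (k.1 1) * pole 0 (k.1 2)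
  + regPole x₃ (k.1 0) * pole 0 (k.1 1) * pole 0 (k.1 2)

theorem hasSum_shuffleKernel {x₁ x₂ x₃ : ℂ} (h₁ : ‖x₁‖ < 1) (h₂ : ‖x₂‖ < 1) (h₃ : ‖x₃‖ < 1) :
    HasSum (shuffleKernel x₁ x₂ x₃)
      (G ![x₁ + x₂ + x₃, x₁ + x₂, x₂] - G ![x₁ + x₂, x₁ + x₂, x₂] - G ![x₂ + x₃, x₂, x₂]
        + G ![x₂, x₂, x₂] - G ![x₁ + x₃, x₁, 0] + G ![x₁, x₁, 0] + G ![x₃, 0, 0]) := by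
  have n12 := norm_add_le x₁ x₂
  have n13 := norm_add_le x₁ x₃
  have n23 := norm_add_le x₂ x₃
  have n123 := norm_add_le (x₁ + x₂) x₃
  have n0 : ‖(0 : ℂ)‖ = 0 := norm_zero
  refine HasSum.add (HasSum.add (HasSum.sub (HasSum.add (HasSum.sub (HasSum.sub
    (hasSum_regPole_pole_pole ?_ ?_ ?_) (hasSum_regPole_pole_pole ?_ ?_ ?_))
    (hasSum_regPole_pole_pole ?_ ?_ ?_)) (hasSum_regPole_pole_pole ?_ ?_ ?_))
    (hasSum_regPole_pole_pole ?_ ?_ ?_)) (hasSum_regPole_pole_pole ?_ ?_ ?_))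
    (hasSum_regPole_pole_pole ?_ ?_ ?_)
  all_goals linarith

/-- The corrections -1/k₁ inside the first factors cancel in pairs, except for that of the last
summand, which supplies the eighth term. What remains is one of the six partial fractions for each
of the eight products in the expansion of R(x₁, a) R(x₂, b) R(x₃, c). -/
theorem shuffleKernel_partialSums (x₁ x₂ x₃ : ℂ) (a b c : ℕ+) :
    shuffleKernel x₁ x₂ x₃ (PosTriple.partialSums (a, b, c)) =
      1 / ((a - x₁) + (b - x₂) + (c - x₃)) * (1 / ((a - x₁) + (b - x₂))) * (1 / (b - x₂))
      - 1 / ((a - x₁) + (b - x₂) + c) * (1 / ((a - x₁) + (b - x₂))) * (1 / (b - x₂))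
      - 1 / (a + (b - x₂) + (c - x₃)) * (1 / (a + (b - x₂))) * (1 / (b - x₂))
      + 1 / (a + (b - x₂) + c) * (1 / (a + (b - x₂))) * (1 / (b - x₂))
      - 1 / ((a - x₁) + b + (c - x₃)) * (1 / ((a - x₁) + b)) * (1 / b)
      + 1 / ((a - x₁) + b + c) * (1 / ((a - x₁) + b)) * (1 / b)
      + 1 / (a + b + (c - x₃)) * (1 / (a + b)) * (1 / b)
      - 1 / (a + b + c) * (1 / (a + b)) * (1 / b) := by
  have e0 : (PosTriple.partialSums (a, b, c)).1 0 = (a : ℕ) + b + c := rfl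
  have e1 : (PosTriple.partialSums (a, b, c)).1 1 = (a : ℕ) + b := rfl
  have e2 : (PosTriple.partialSums (a, b, c)).1 2 = (b : ℕ) := rfl
  simp only [shuffleKernel, regPole, pole, e0, e1, e2, Nat.cast_add, sub_zero]
  rw [show (a : ℂ) - x₁ + (b - x₂) + (c - x₃) = a + b + c - (x₁ + x₂ + x₃) by ring,
    show (a : ℂ) - x₁ + (b - x₂) + c = a + b + c - (x₁ + x₂) by ring,
    show (a : ℂ) + (b - x₂) + (c - x₃) = a + b + c - (x₂ + x₃) by ring,
    show (a : ℂ) - x₁ + (b - x₂) = a + b - (x₁ + x₂) by ring,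
    show (a : ℂ) + (b - x₂) + c = a + b + c - x₂ by ring,
    show (a : ℂ) + (b - x₂) = a + b - x₂ by ring,
    show (a : ℂ) - x₁ + b + (c - x₃) = a + b + c - (x₁ + x₃) by ring,
    show (a : ℂ) - x₁ + b + c = a + b + c - x₁ by ring,
    show (a : ℂ) - x₁ + b = a + b - x₁ by ring,
    show (a : ℂ) + b + (c - x₃) = a + b + c - x₃ by ring]
  ring

/-- The 8 · 6 terms of the expansion are grouped by ordering rather than by product: the eight
products do not give convergent series separately, while each group is a combination of summands of
convergent G's. -/
theorem regPole_mul_mul_eq {x₁ x₂ x₃ : ℂ} (h₁ : ‖x₁‖ < 1) (h₂ : ‖x₂‖ < 1) (h₃ : ‖x₃‖ < 1)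
    (a b c : ℕ+) :
    regPole x₁ a * (regPole x₂ b * regPole x₃ c) =
      shuffleKernel x₁ x₂ x₃ (PosTriple.partialSums (a, b, c))
      + shuffleKernel x₁ x₃ x₂ (PosTriple.partialSums (a, c, b))
      + shuffleKernel x₂ x₁ x₃ (PosTriple.partialSums (b, a, c))
      + shuffleKernel x₂ x₃ x₁ (PosTriple.partialSums (b, c, a))
      + shuffleKernel x₃ x₁ x₂ (PosTriple.partialSums (c, a, b))
      + shuffleKernel x₃ x₂ x₁ (PosTriple.partialSums (c, b, a)) := by
  have pos : ∀ n : ℕ+, 0 < ((n : ℕ) : ℂ).re := fun n => by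
    rw [Complex.natCast_re]
    exact_mod_cast n.2
  have pos' : ∀ (n : ℕ+) (x : ℂ), ‖x‖ < 1 → 0 < (((n : ℕ) : ℂ) - x).re := fun n x hx => by
    have h1 : x.re < 1 := (Complex.re_le_norm x).trans_lt hx
    have h2 : (1 : ℝ) ≤ (n : ℕ) := by exact_mod_cast n.2
    rw [Complex.sub_re, Complex.natCast_re]
    linarith
  simp only [shuffleKernel_partialSums, regPole]
  have A := pos' a x₁ h₁
  have B := pos' b x₂ h₂
  have C := pos' c x₃ h₃
  have A0 := pos a
  have B0 := pos b
  have C0 := pos c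
  generalize ((a : ℕ) : ℂ) - x₁ = a' at *
  generalize ((b : ℕ) : ℂ) - x₂ = b' at *
  generalize ((c : ℕ) : ℂ) - x₃ = c' at *
  generalize ((a : ℕ) : ℂ) = a at *
  generalize ((b : ℕ) : ℂ) = b at *
  generalize ((c : ℕ) : ℂ) = c at *
  have expand : (1 / a' - 1 / a) * ((1 / b' - 1 / b) * (1 / c' - 1 / c)) =
      1 / a' * (1 / b' * (1 / c')) - 1 / a' * (1 / b' * (1 / c)) - 1 / a' * (1 / b * (1 / c'))
      + 1 / a' * (1 / b * (1 / c)) - 1 / a * (1 / b' * (1 / c')) + 1 / a * (1 / b' * (1 / c))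
      + 1 / a * (1 / b * (1 / c')) - 1 / a * (1 / b * (1 / c)) := by ring
  rw [expand, one_div_mul_mul_eq A B C, one_div_mul_mul_eq A B C0, one_div_mul_mul_eq A B0 C,
    one_div_mul_mul_eq A B0 C0, one_div_mul_mul_eq A0 B C, one_div_mul_mul_eq A0 B C0,
    one_div_mul_mul_eq A0 B0 C, one_div_mul_mul_eq A0 B0 C0]
  ring

theorem hasSum_partialSums {T : DecrIndex 3 → ℂ} {t : ℂ} (h : HasSum T t)
    (σ : PosTriple ≃ PosTriple) : HasSum (fun p => T (PosTriple.partialSums (σ p))) t :=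
  (σ.trans PosTriple.partialSums).hasSum_iff.2 h

/-- The shuffle product of three generating functions of depth one. -/
theorem G_mul_mul_shuffle {x₁ x₂ x₃ : ℂ} (h₁ : ‖x₁‖ < 1) (h₂ : ‖x₂‖ < 1) (h₃ : ‖x₃‖ < 1) :
    G ![x₁] * (G ![x₂] * G ![x₃]) = symSum₃ (fun x₁ x₂ x₃ =>
      G ![x₁ + x₂ + x₃, x₁ + x₂, x₂] - G ![x₁ + x₂, x₁ + x₂, x₂] - G ![x₂ + x₃, x₂, x₂]
        + G ![x₂, x₂, x₂] - G ![x₁ + x₃, x₁, 0] + G ![x₁, x₁, 0] + G ![x₃, 0, 0]) x₁ x₂ x₃ := by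
  have H := ((((hasSum_partialSums (hasSum_shuffleKernel h₁ h₂ h₃) (Equiv.refl _)).add
    (hasSum_partialSums (hasSum_shuffleKernel h₁ h₃ h₂)
      ((PosTriple.rot.trans PosTriple.rot).trans PosTriple.swap))).add
    (hasSum_partialSums (hasSum_shuffleKernel h₂ h₁ h₃) PosTriple.swap)).add
    (hasSum_partialSums (hasSum_shuffleKernel h₂ h₃ h₁) PosTriple.rot)).add
    (hasSum_partialSums (hasSum_shuffleKernel h₃ h₁ h₂) (PosTriple.rot.trans PosTriple.rot))
    |>.add
    (hasSum_partialSums (hasSum_shuffleKernel h₃ h₂ h₁) (PosTriple.rot.trans PosTriple.swap))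
  have hp := hasSum_posTriple (hasSum_regPole h₁).summable (hasSum_regPole h₂).summable
    (hasSum_regPole h₃).summable
  have e : ∀ {x : ℂ}, ‖x‖ < 1 → iterSum₁ (regPole x) = G ![x] := fun hx =>
    (hasSum_regPole hx).tsum_eq
  rw [e h₁, e h₂, e h₃] at hp
  refine hp.unique (H.congr_fun fun p => ?_)
  exact regPole_mul_mul_eq h₁ h₂ h₃ p.1 p.2.1 p.2.2

/-! ### Series with a fixed exponent -/

theorem isAdmissible_pair {a b : ℕ} (ha : 2 ≤ a) (hb : 1 ≤ b) : IsAdmissible ![a, b] := by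
  constructor
  · intro i
    fin_cases i
    · exact one_le_two.trans ha
    · exact hb
  · intro i hi
    fin_cases i
    · exact ha
    · simp at hi

theorem isAdmissible_triple {a b c : ℕ} (ha : 2 ≤ a) (hb : 1 ≤ b) (hc : 1 ≤ c) :
    IsAdmissible ![a, b, c] := by
  constructor
  · intro i
    fin_cases i
    · exact one_le_two.trans ha
    · exact hb
    · exact hc
  · intro i hi
    fin_cases i
    · exact ha
    · simp at hi
    · simp at hi

/-- The index `(s, b)`. -/
def pairLeft (b : ℕ) (hb : 1 ≤ b) (s : GeTwo) : {s : Fin 2 → ℕ // IsAdmissible s} :=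
  ⟨![s.1, b], isAdmissible_pair s.2 hb⟩

/-- The index `(2, s)`. -/
def pairRight (s : GeTwo) : {s : Fin 2 → ℕ // IsAdmissible s} :=
  ⟨![2, s.1], isAdmissible_pair le_rfl (one_le_two.trans s.2)⟩

/-- The index `(r₁, r₂, 1)`. -/
def tripleLast (r : GeTwoOne) : {s : Fin 3 → ℕ // IsAdmissible s} :=
  ⟨![r.1.1, r.1.2, 1], isAdmissible_triple r.2.1 r.2.2 le_rfl⟩

/-- The index `(r₁, 1, r₂)`. -/
def tripleMid (r : GeTwoOne) : {s : Fin 3 → ℕ // IsAdmissible s} :=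
  ⟨![r.1.1, 1, r.1.2], isAdmissible_triple r.2.1 le_rfl r.2.2⟩

theorem pairLeft_injective (b : ℕ) (hb : 1 ≤ b) : Function.Injective (pairLeft b hb) := by
  intro s t h
  exact Subtype.ext (congrFun (congrArg Subtype.val h) 0)

theorem pairRight_injective : Function.Injective pairRight := by
  intro s t h
  exact Subtype.ext (congrFun (congrArg Subtype.val h) 1)

theorem tripleLast_injective : Function.Injective tripleLast := by
  intro s t h
  exact Subtype.ext (Prod.ext (congrFun (congrArg Subtype.val h) 0)
    (congrFun (congrArg Subtype.val h) 1))

theorem tripleMid_injective : Function.Injective tripleMid := by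
  intro s t h
  exact Subtype.ext (Prod.ext (congrFun (congrArg Subtype.val h) 0)
    (congrFun (congrArg Subtype.val h) 2))

/-- As 0 ^ 0 = 1, a zero argument selects exactly the indices with exponent 1 in that position. -/
theorem genTerm_eq_zero {d : ℕ} {y : Fin d → ℂ} {s : {s : Fin d → ℕ // IsAdmissible s}} {i : Fin d}
    (hi : y i = 0) (hs : s.1 i ≠ 1) : genTerm y s = 0 := by
  have h := s.2.1 i
  rw [genTerm, Finset.prod_eq_zero (Finset.mem_univ i), zero_mul]
  rw [hi, zero_pow]
  omega

theorem summable_genTerm_one {x : ℂ} (hx : ‖x‖ < 1) : Summable (genTerm ![x]) :=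
  summable_genTerm fun i => by
    fin_cases i
    simpa using hx

theorem summable_genTerm_two {x y : ℂ} (hx : ‖x‖ < 2) (hy : ‖y‖ < 1) :
    Summable (genTerm ![x, y]) :=
  summable_genTerm fun i => by
    fin_cases i
    · simpa using hx
    · simpa using hy

theorem summable_genTerm_three {x y z : ℂ} (hx : ‖x‖ < 3) (hy : ‖y‖ < 2) (hz : ‖z‖ < 1) :
    Summable (genTerm ![x, y, z]) :=
  summable_genTerm fun i => by
    fin_cases i
    · simpa using hx
    · simpa using hy
    · simpa using hz

theorem hasSum_zeta_pair_one {x : ℂ} (hx : ‖x‖ < 1) :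
    HasSum (fun s : GeTwo => x ^ (s.1 - 1) * (zeta ![s.1, 1] : ℂ)) (G ![x, 0]) := by
  have h := (summable_genTerm_two (x := x) (y := 0) (by linarith) (by simp)).hasSum
  rw [← (pairLeft_injective 1 le_rfl).hasSum_iff fun s hs =>
    genTerm_eq_zero (i := 1) rfl fun h1 => hs ⟨⟨s.1 0, s.2.2 0 rfl⟩, Subtype.ext ?_⟩] at h
  · refine h.congr_fun fun s => ?_
    simp [genTerm, pairLeft, Fin.prod_univ_two]
  · ext i
    fin_cases i
    · rfl
    · exact h1.symm

theorem hasSum_zeta_triple_last {x y : ℂ} (hx : ‖x‖ < 3) (hy : ‖y‖ < 2) :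
    HasSum (fun r : GeTwoOne => x ^ (r.1.1 - 1) * y ^ (r.1.2 - 1)
      * (zeta ![r.1.1, r.1.2, 1] : ℂ)) (G ![x, y, 0]) := by
  have h := (summable_genTerm_three (x := x) (y := y) (z := 0) hx hy (by simp)).hasSum
  rw [← tripleLast_injective.hasSum_iff fun s hs =>
    genTerm_eq_zero (i := 2) rfl fun h1 =>
      hs ⟨⟨(s.1 0, s.1 1), s.2.2 0 rfl, s.2.1 1⟩, Subtype.ext ?_⟩] at h
  · refine h.congr_fun fun s => ?_
    simp [genTerm, tripleLast, Fin.prod_univ_three]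
  · ext i
    fin_cases i
    · rfl
    · rfl
    · exact h1.symm

theorem hasSum_zeta_triple_mid {x y : ℂ} (hx : ‖x‖ < 3) (hy : ‖y‖ < 1) :
    HasSum (fun r : GeTwoOne => x ^ (r.1.1 - 1) * y ^ (r.1.2 - 1)
      * (zeta ![r.1.1, 1, r.1.2] : ℂ)) (G ![x, 0, y]) := by
  have h := (summable_genTerm_three (x := x) (y := 0) (z := y) hx (by simp) hy).hasSum
  rw [← tripleMid_injective.hasSum_iff fun s hs =>
    genTerm_eq_zero (i := 1) rfl fun h1 =>
      hs ⟨⟨(s.1 0, s.1 2), s.2.2 0 rfl, s.2.1 2⟩, Subtype.ext ?_⟩] at h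
  · refine h.congr_fun fun s => ?_
    simp [genTerm, tripleMid, Fin.prod_univ_three]
  · ext i
    fin_cases i
    · rfl
    · exact h1.symm
    · rfl

/-- The integers `s ≥ 2` correspond to the natural numbers. -/
def geTwoEquiv : ℕ ≃ GeTwo where
  toFun t := ⟨t + 2, Nat.le_add_left _ _⟩
  invFun s := s.1 - 2
  left_inv _ := rfl
  right_inv s := Subtype.ext (Nat.sub_add_cancel s.2)

theorem hasSum_geTwo {x : ℂ} {n : ℕ} (h : ‖x‖ < n) :
    HasSum (fun s : GeTwo => x ^ (s.1 - 1) * (1 / (n : ℂ) ^ s.1)) (regPole x n) := by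
  rw [← geTwoEquiv.hasSum_iff, ← regPole_eq h]
  have h1 := (hasSum_geometric_excess h 1).2
  rw [pow_one] at h1
  exact h1

theorem hasSum_zeta_pair_two {x : ℂ} (hx : ‖x‖ < 1) :
    HasSum (fun k : DecrIndex 2 => regPole x (k.1 0) * (1 / (k.1 1 : ℂ) ^ 2))
      (∑' s : GeTwo, x ^ (s.1 - 1) * (zeta ![s.1, 2] : ℂ)) ∧
    Summable (fun s : GeTwo => x ^ (s.1 - 1) * (zeta ![s.1, 2] : ℂ)) := by
  -- A zero argument cannot select the exponent 2. The subfamily is taken at a nonzero value of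
  -- modulus below 1; the resulting factor 1/2 is removed at the end.
  have h := hasSum_genTerm_comp (y := ![x, 1 / 2]) (fun i => by
    fin_cases i
    · simp; linarith
    · simp; norm_num) (pairLeft_injective 2 one_le_two)
  have hg : ∀ s : GeTwo, genTerm ![x, 1 / 2] (pairLeft 2 one_le_two s)
      = 1 / 2 * (x ^ (s.1 - 1) * (zeta ![s.1, 2] : ℂ)) := fun s => by
    simp [genTerm, pairLeft, Fin.prod_univ_two]
    ring
  have hk : ∀ k : DecrIndex 2, ∑' s, genFamily ![x, 1 / 2] (pairLeft 2 one_le_two s) k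
      = 1 / 2 * (regPole x (k.1 0) * (1 / (k.1 1 : ℂ) ^ 2)) := fun k => by
    have hn : ‖x‖ < k.1 0 := hx.trans_le (by exact_mod_cast k.2.2 0)
    refine HasSum.tsum_eq ?_
    rw [mul_left_comm, mul_comm]
    refine (((hasSum_geTwo hn).mul_left _)).congr_fun fun s => ?_
    simp [genFamily, pairLeft, Fin.prod_univ_two]
    ring
  simp only [hg, hk] at h
  have h1 := h.1.hasSum.mul_left 2
  have h2 := h.2.mul_left 2
  simp only [← mul_assoc, mul_one_div_cancel (two_ne_zero' ℂ), one_mul] at h1 h2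
  refine ⟨?_, h2.summable⟩
  rw [h2.tsum_eq]
  exact h1

theorem hasSum_zeta_two_pair {x : ℂ} (hx : ‖x‖ < 1) :
    HasSum (fun k : DecrIndex 2 => 1 / (k.1 0 : ℂ) ^ 2 * regPole x (k.1 1))
      (∑' s : GeTwo, x ^ (s.1 - 1) * (zeta ![2, s.1] : ℂ)) ∧
    Summable (fun s : GeTwo => x ^ (s.1 - 1) * (zeta ![2, s.1] : ℂ)) := by
  -- The first argument may have modulus up to 2, so the value 1 is allowed and leaves no factor.
  have h := hasSum_genTerm_comp (y := ![1, x]) (fun i => by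
    fin_cases i
    · simp
    · simpa using hx) pairRight_injective
  have hg : ∀ s : GeTwo, genTerm ![1, x] (pairRight s)
      = x ^ (s.1 - 1) * (zeta ![2, s.1] : ℂ) := fun s => by
    simp [genTerm, pairRight, Fin.prod_univ_two]
  have hk : ∀ k : DecrIndex 2, ∑' s, genFamily ![1, x] (pairRight s) k
      = 1 / (k.1 0 : ℂ) ^ 2 * regPole x (k.1 1) := fun k => by
    have hn : ‖x‖ < k.1 1 := hx.trans_le (by exact_mod_cast k.2.2 1)
    refine HasSum.tsum_eq ?_
    refine (((hasSum_geTwo hn).mul_left _)).congr_fun fun s => ?_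
    simp [genFamily, pairRight, Fin.prod_univ_two]
  simp only [hg, hk] at h
  refine ⟨?_, h.2.summable⟩
  rw [h.2.tsum_eq]
  exact h.1.hasSum

theorem hasSum_zeta_single {a : ℕ} (ha : 2 ≤ a) :
    HasSum (fun k : DecrIndex 1 => 1 / (k.1 0 : ℂ) ^ a) (zeta ![a] : ℂ) := by
  have h : Summable (zetaTerm ![a]) := summable_zetaTerm ⟨fun i => by
    fin_cases i
    exact one_le_two.trans ha, fun i _ => by
    fin_cases i
    exact ha⟩
  refine (Complex.hasSum_ofReal.2 h.hasSum).congr_fun fun k => ?_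
  simp [zetaTerm]

/-- The bound needed for the series in `x ^ (s - 2)`, where `x = 0` is allowed. -/
theorem summable_zeta_pair_one_sub_two {x : ℂ} (hx : ‖x‖ < 1) :
    Summable (fun s : GeTwo => x ^ (s.1 - 2) * (zeta ![s.1, 1] : ℂ)) := by
  -- Comparison at a positive radius r, where lowering the exponent by one only costs r⁻¹.
  obtain ⟨r, hr, hr1⟩ := exists_between hx
  have hr0 : 0 < r := (norm_nonneg x).trans_lt hr
  have h := (hasSum_zeta_pair_one (x := (r : ℂ))
    (by rwa [Complex.norm_real, Real.norm_of_nonneg hr0.le])).summable.norm.mul_left r⁻¹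
  refine Summable.of_norm_bounded h fun s => ?_
  obtain ⟨s, hs⟩ := s
  obtain ⟨t, rfl⟩ := Nat.exists_eq_add_of_le' hs
  simp only [norm_mul, norm_pow, Complex.norm_real, Real.norm_of_nonneg hr0.le,
    Nat.add_sub_cancel, show t + 2 - 1 = t + 1 from rfl, pow_succ]
  rw [← mul_assoc, mul_comm (r ^ t) r, inv_mul_cancel_left₀ hr0.ne']
  gcongr

theorem tsum_zeta_pair_one_sub_two {x : ℂ} (hx : ‖x‖ < 1) (h0 : x ≠ 0) :
    ∑' s : GeTwo, x ^ (s.1 - 2) * (zeta ![s.1, 1] : ℂ) = G ![x, 0] / x := by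
  rw [eq_div_iff h0, ← tsum_mul_right, ← (hasSum_zeta_pair_one hx).tsum_eq]
  refine tsum_congr fun s => ?_
  obtain ⟨s, hs⟩ := s
  obtain ⟨t, rfl⟩ := Nat.exists_eq_add_of_le' hs
  simp only [Nat.add_sub_cancel, show t + 2 - 1 = t + 1 from rfl, pow_succ]
  ring

theorem hasSum_zeta_triple_symm {y z : ℂ} (hy : ‖y‖ < 1) (hz : ‖z‖ < 1) :
    HasSum (fun r : GeTwoOne =>
      y ^ (r.1.2 - 1) * ((y + z) ^ (r.1.1 - 1) - y ^ (r.1.1 - 1) - z ^ (r.1.1 - 1))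
        * (zeta ![r.1.1, r.1.2, 1] : ℂ)) (G ![y + z, y, 0] - G ![y, y, 0] - G ![z, y, 0]) := by
  have h := norm_add_le y z
  refine (((hasSum_zeta_triple_last (x := y + z) (y := y) (by linarith) (by linarith)).sub
    (hasSum_zeta_triple_last (x := y) (y := y) (by linarith) (by linarith))).sub
    (hasSum_zeta_triple_last (x := z) (y := y) (by linarith) (by linarith))).congr_fun fun r => ?_
  ring

/-! ### Partial fractions at coinciding indices -/

theorem regPole_eq_sub (x : ℂ) (n : ℕ) : regPole x n = pole x n - pole 0 n := by
  simp [regPole, pole]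

/-- Writing P_x = 1/(n - x), expand (P_x - P_0)(P_y - P_0) and use P_x P_y = (P_x - P_y)/(x - y),
including y = 0; the square P_0² gives 1/n². -/
theorem regPole_mul_regPole {x y : ℂ} {n : ℕ} (hx : ‖x‖ < n) (hy : ‖y‖ < n) (x0 : x ≠ 0)
    (y0 : y ≠ 0) (hxy : x ≠ y) :
    regPole x n * regPole y n =
      (regPole x n - regPole y n) / (x - y) - regPole x n / x - regPole y n / y
        + 1 / (n : ℂ) ^ 2 := by
  have h1 := natCast_sub_ne_zero hx
  have h2 := natCast_sub_ne_zero hy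
  have h3 : (n : ℂ) ≠ 0 := by
    have := (norm_nonneg x).trans_lt hx
    exact_mod_cast this.ne'
  have h4 : x - y ≠ 0 := sub_ne_zero.2 hxy
  rw [← regPole_eq hx, ← regPole_eq hy]
  field_simp
  ring

theorem regPole_div_sq {x : ℂ} {n : ℕ} (hx : ‖x‖ < n) (x0 : x ≠ 0) :
    regPole x n * (1 / (n : ℂ) ^ 2) =
      regPole x n / x ^ 2 - 1 / (n : ℂ) ^ 2 / x - 1 / (n : ℂ) ^ 3 := by
  have h1 := natCast_sub_ne_zero hx
  have h3 : (n : ℂ) ≠ 0 := by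
    have := (norm_nonneg x).trans_lt hx
    exact_mod_cast this.ne'
  rw [← regPole_eq hx]
  field_simp
  ring

theorem DecrIndex.norm_lt {d : ℕ} (k : DecrIndex d) (i : Fin d) {x : ℂ} (hx : ‖x‖ < 1) :
    ‖x‖ < k.1 i := hx.trans_le (by exact_mod_cast k.2.2 i)

/-- Only the two inner factors are split into poles; the outer one stays regularized, so all four
pieces converge. -/
theorem iterSum₃_regPole {x y z : ℂ} (hx : ‖x‖ < 1) (hy : ‖y‖ < 1) (hz : ‖z‖ < 1) :
    iterSum₃ (regPole x) (regPole y) (regPole z)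
      = G ![x, y, z] - G ![x, 0, z] - G ![x, y, 0] + G ![x, 0, 0] := by
  have n0 : ‖(0 : ℂ)‖ < 1 := by simp
  have h : ∀ {y z : ℂ}, ‖y‖ < 1 → ‖z‖ < 1 → _ := fun {y z} hy hz =>
    hasSum_regPole_pole_pole (x := x) (y := y) (z := z) (by linarith) (by linarith) hz
  refine HasSum.tsum_eq (((((h hy hz).sub (h n0 hz)).sub (h hy n0)).add (h n0 n0)).congr_fun
    fun k => ?_)
  rw [regPole_eq_sub y, regPole_eq_sub z]
  ring

theorem hasSum_regPole_regPole {x y : ℂ} (hx : ‖x‖ < 1) (hy : ‖y‖ < 1) :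
    HasSum (fun k : DecrIndex 2 => regPole x (k.1 0) * regPole y (k.1 1))
      (G ![x, y] - G ![x, 0]) := by
  refine ((hasSum_regPole_pole (x := x) (y := y) (by linarith) hy).sub
    (hasSum_regPole_pole (x := x) (y := 0) (by linarith) (by simp))).congr_fun fun k => ?_
  rw [regPole_eq_sub y]
  ring

theorem iterSum₂_mul_left {x y z : ℂ} (hx : ‖x‖ < 1) (hy : ‖y‖ < 1) (hz : ‖z‖ < 1)
    (x0 : x ≠ 0) (y0 : y ≠ 0) (hxy : x ≠ y) :
    iterSum₂ (regPole x * regPole y) (regPole z) =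
      ((G ![x, z] - G ![x, 0]) - (G ![y, z] - G ![y, 0])) / (x - y)
      - (G ![x, z] - G ![x, 0]) / x - (G ![y, z] - G ![y, 0]) / y
      + ∑' s : GeTwo, z ^ (s.1 - 1) * (zeta ![2, s.1] : ℂ) := by
  have h1 := hasSum_regPole_regPole hx hz
  have h2 := hasSum_regPole_regPole hy hz
  refine HasSum.tsum_eq ((((((h1.sub h2).div_const (x - y)).sub (h1.div_const x)).sub
    (h2.div_const y)).add (hasSum_zeta_two_pair hz).1).congr_fun fun k => ?_)
  rw [Pi.mul_apply, regPole_mul_regPole (k.norm_lt 0 hx) (k.norm_lt 0 hy) x0 y0 hxy]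
  ring

theorem iterSum₂_mul_right {x y z : ℂ} (hx : ‖x‖ < 1) (hy : ‖y‖ < 1) (hz : ‖z‖ < 1)
    (x0 : x ≠ 0) (y0 : y ≠ 0) (hxy : x ≠ y) :
    iterSum₂ (regPole z) (regPole x * regPole y) =
      (G ![z, x] - G ![z, y]) / (x - y)
      - (G ![z, x] - G ![z, 0]) / x - (G ![z, y] - G ![z, 0]) / y
      + ∑' s : GeTwo, z ^ (s.1 - 1) * (zeta ![s.1, 2] : ℂ) := by
  have h1 := hasSum_regPole_regPole hz hx
  have h2 := hasSum_regPole_regPole hz hy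
  have h := (((((h1.sub h2).div_const (x - y)).sub (h1.div_const x)).sub
    (h2.div_const y)).add (hasSum_zeta_pair_two hz).1)
  -- The two terms G(z, 0) cancel in the difference.
  rw [sub_sub_sub_cancel_right] at h
  refine HasSum.tsum_eq (h.congr_fun fun k => ?_)
  rw [Pi.mul_apply, regPole_mul_regPole (k.norm_lt 1 hx) (k.norm_lt 1 hy) x0 y0 hxy]
  ring

theorem iterSum₁_mul {x y z : ℂ} (hx : ‖x‖ < 1) (hy : ‖y‖ < 1) (hz : ‖z‖ < 1)
    (x0 : x ≠ 0) (y0 : y ≠ 0) (z0 : z ≠ 0) (hxy : x ≠ y) (hxz : x ≠ z) (hyz : y ≠ z) :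
    iterSum₁ (regPole x * regPole y * regPole z) =
      G ![x] * (1 / ((x - y) * (x - z)) - 1 / (x * (x - y)) - 1 / (x * (x - z)) + 1 / x ^ 2)
      + G ![y] * (1 / ((y - x) * (y - z)) - 1 / (y * (y - x)) - 1 / (y * (y - z)) + 1 / y ^ 2)
      + G ![z] * (1 / ((z - x) * (z - y)) - 1 / (z * (z - x)) - 1 / (z * (z - y)) + 1 / z ^ 2)
      - zeta ![2] * (1 / x + 1 / y + 1 / z) - zeta ![3] := by
  refine HasSum.tsum_eq ((((((hasSum_regPole hx).mul_right _).add
    ((hasSum_regPole hy).mul_right _)).add ((hasSum_regPole hz).mul_right _)).sub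
    ((hasSum_zeta_single le_rfl).mul_right _)).sub
    (hasSum_zeta_single (by norm_num))|>.congr_fun fun k => ?_)
  have e1 := regPole_mul_regPole (k.norm_lt 0 hx) (k.norm_lt 0 hy) x0 y0 hxy
  have e2 := regPole_mul_regPole (k.norm_lt 0 hx) (k.norm_lt 0 hz) x0 z0 hxz
  have e3 := regPole_mul_regPole (k.norm_lt 0 hy) (k.norm_lt 0 hz) y0 z0 hyz
  have e4 := regPole_div_sq (k.norm_lt 0 hz) z0
  -- The first product is made linear, then each resulting term is multiplied by the third factor
  -- and made linear again; the 1/n² term needs `regPole_div_sq`.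
  rw [Pi.mul_apply, Pi.mul_apply, e1, add_mul, mul_comm (1 / ((k.1 0 : ℕ) : ℂ) ^ 2), e4, sub_mul,
    sub_mul, div_mul_eq_mul_div, div_mul_eq_mul_div, div_mul_eq_mul_div, sub_mul, e2, e3]
  have d1 := sub_ne_zero.2 hxy
  have d2 := sub_ne_zero.2 hxz
  have d3 := sub_ne_zero.2 hyz
  rw [← neg_sub x y, ← neg_sub x z, ← neg_sub y z]
  generalize regPole x (k.1 0) = A
  generalize regPole y (k.1 0) = B
  generalize regPole z (k.1 0) = C
  generalize 1 / ((k.1 0 : ℕ) : ℂ) ^ 2 = D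
  field_simp
  ring

/-! ### Comparison of the two products -/

/-- The harmonic product of three generating functions of depth one. -/
theorem G_mul_mul_harmonic {x₁ x₂ x₃ : ℂ} (h₁ : ‖x₁‖ < 1) (h₂ : ‖x₂‖ < 1) (h₃ : ‖x₃‖ < 1) :
    G ![x₁] * (G ![x₂] * G ![x₃]) =
      symSum₃ (fun x₁ x₂ x₃ =>
        G ![x₁, x₂, x₃] - G ![x₁, 0, x₃] - G ![x₁, x₂, 0] + G ![x₁, 0, 0]) x₁ x₂ x₃
      + cycSum₃ (fun x₁ x₂ x₃ => iterSum₂ (regPole x₁ * regPole x₂) (regPole x₃)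
        + iterSum₂ (regPole x₁) (regPole x₂ * regPole x₃)) x₁ x₂ x₃
      + iterSum₁ (regPole x₁ * regPole x₂ * regPole x₃) := by
  have e : ∀ {x : ℂ}, ‖x‖ < 1 → iterSum₁ (regPole x) = G ![x] := fun hx =>
    (hasSum_regPole hx).tsum_eq
  have h := iterSum₁_mul_mul (hasSum_regPole h₁).summable (hasSum_regPole h₂).summable
    (hasSum_regPole h₃).summable
  rw [e h₁, e h₂, e h₃, iterSum₃_regPole h₁ h₂ h₃, iterSum₃_regPole h₃ h₁ h₂,
    iterSum₃_regPole h₂ h₃ h₁, iterSum₃_regPole h₂ h₁ h₃, iterSum₃_regPole h₃ h₂ h₁,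
    iterSum₃_regPole h₁ h₃ h₂] at h
  rw [h]
  simp only [symSum₃, cycSum₃]
  ring

theorem generating_function_relation {x₁ x₂ x₃ : ℂ} (h₁ : ‖x₁‖ < 1) (h₂ : ‖x₂‖ < 1)
    (h₃ : ‖x₃‖ < 1) (z₁ : x₁ ≠ 0) (z₂ : x₂ ≠ 0) (z₃ : x₃ ≠ 0) (h₁₂ : x₁ ≠ x₂) (h₁₃ : x₁ ≠ x₃)
    (h₂₃ : x₂ ≠ x₃) :
    symSum₃ (fun x₁ x₂ x₃ =>
          G ![x₁ + x₂ + x₃, x₁ + x₂, x₂] - G ![x₁ + x₂, x₁ + x₂, x₂]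
          - G ![x₂ + x₃, x₂, x₂] + G ![x₂, x₂, x₂] - G ![x₁, x₂, x₃]
          - (G ![x₁, x₃] + G ![x₃, x₁]) / (x₃ - x₂)
          + G ![x₁, x₂] / x₂ + G ![x₂, x₁] / x₂) x₁ x₂ x₃
      - cycSum₂ (fun x₂ x₃ =>
          1 / (x₃ - x₂) * ((G ![x₃] - G ![x₁]) / (x₃ - x₁) + G ![x₂] / x₂)
          - (G ![x₂] - G ![x₁]) / (x₂ * (x₂ - x₁))
          + G ![x₁] / (x₁ * x₂)) x₂ x₃
      = symSum₃ (fun x₁ x₂ x₃ =>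
          (∑' r : GeTwoOne,
            x₁ ^ (r.1.2 - 1)
              * ((x₁ + x₃) ^ (r.1.1 - 1) - x₁ ^ (r.1.1 - 1) - x₃ ^ (r.1.1 - 1))
              * (zeta ![r.1.1, r.1.2, 1] : ℂ))
          + (∑' s : GeTwo, x₁ ^ (s.1 - 2) * (zeta ![s.1, 1] : ℂ))
          - (∑' r : GeTwoOne,
              x₁ ^ (r.1.1 - 1) * x₃ ^ (r.1.2 - 1) * (zeta ![r.1.1, 1, r.1.2] : ℂ))
          + 1 / x₂ * (∑' s : GeTwo, x₁ ^ (s.1 - 1) * (zeta ![s.1, 1] : ℂ))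
          - (∑' s : GeTwo,
              x₃ ^ (s.1 - 1) / (x₃ - x₂) * (zeta ![s.1, 1] : ℂ))) x₁ x₂ x₃
      + cycSum₃ (fun x₁ _ _ =>
          (∑' s : GeTwo, x₁ ^ (s.1 - 1) * (zeta ![s.1, 2] : ℂ))
          + (∑' s : GeTwo, x₁ ^ (s.1 - 1) * (zeta ![2, s.1] : ℂ))
          + G ![x₁] / x₁ ^ 2 - (zeta ![2] : ℂ) / x₁) x₁ x₂ x₃
      - (zeta ![3] : ℂ) := by
  have h := (G_mul_mul_shuffle h₁ h₂ h₃).symm.trans (G_mul_mul_harmonic h₁ h₂ h₃)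
  have hT : ∀ x y : ℂ, ‖x‖ < 1 → ∑' s : GeTwo, x ^ (s.1 - 1) / (x - y) * (zeta ![s.1, 1] : ℂ)
      = G ![x, 0] / (x - y) := fun x y hx => by
    rw [← (hasSum_zeta_pair_one hx).tsum_eq, ← tsum_div_const]
    exact tsum_congr fun s => by ring
  have hL : ∀ y z : ℂ, ‖y‖ < 1 → ‖z‖ < 1 → _ := fun y z hy hz =>
    (hasSum_zeta_triple_symm hy hz).tsum_eq
  have hM : ∀ y z : ℂ, ‖y‖ < 1 → ‖z‖ < 1 → _ := fun y z hy hz =>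
    (hasSum_zeta_triple_mid (x := y) (y := z) (by linarith) hz).tsum_eq
  simp only [symSum₃, cycSum₃, cycSum₂] at h ⊢
  rw [iterSum₂_mul_left h₁ h₂ h₃ z₁ z₂ h₁₂, iterSum₂_mul_left h₂ h₃ h₁ z₂ z₃ h₂₃,
    iterSum₂_mul_left h₃ h₁ h₂ z₃ z₁ h₁₃.symm, iterSum₂_mul_right h₂ h₃ h₁ z₂ z₃ h₂₃,
    iterSum₂_mul_right h₃ h₁ h₂ z₃ z₁ h₁₃.symm, iterSum₂_mul_right h₁ h₂ h₃ z₁ z₂ h₁₂,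
    iterSum₁_mul h₁ h₂ h₃ z₁ z₂ z₃ h₁₂ h₁₃ h₂₃] at h
  rw [hL x₁ x₃ h₁ h₃, hL x₁ x₂ h₁ h₂, hL x₂ x₃ h₂ h₃, hL x₂ x₁ h₂ h₁, hL x₃ x₂ h₃ h₂,
    hL x₃ x₁ h₃ h₁, hM x₁ x₃ h₁ h₃, hM x₁ x₂ h₁ h₂, hM x₂ x₃ h₂ h₃, hM x₂ x₁ h₂ h₁,
    hM x₃ x₂ h₃ h₂, hM x₃ x₁ h₃ h₁, hT x₃ x₂ h₃, hT x₂ x₃ h₂, hT x₃ x₁ h₃, hT x₁ x₃ h₁,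
    hT x₂ x₁ h₂, hT x₁ x₂ h₁, (hasSum_zeta_pair_one h₁).tsum_eq,
    (hasSum_zeta_pair_one h₂).tsum_eq, (hasSum_zeta_pair_one h₃).tsum_eq,
    tsum_zeta_pair_one_sub_two h₁ z₁, tsum_zeta_pair_one_sub_two h₂ z₂,
    tsum_zeta_pair_one_sub_two h₃ z₃]
  have d₁₂ := sub_ne_zero.2 h₁₂
  have d₁₃ := sub_ne_zero.2 h₁₃
  have d₂₃ := sub_ne_zero.2 h₂₃
  -- The sum over x₂, x₃ is in fact symmetric in all three variables: it is the depth-one part of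
  -- `iterSum₁_mul` without the terms G(x)/x², which stand on the other side.
  have cyc : 1 / (x₃ - x₂) * ((G ![x₃] - G ![x₁]) / (x₃ - x₁) + G ![x₂] / x₂)
        - (G ![x₂] - G ![x₁]) / (x₂ * (x₂ - x₁)) + G ![x₁] / (x₁ * x₂)
      + (1 / (x₂ - x₃) * ((G ![x₂] - G ![x₁]) / (x₂ - x₁) + G ![x₃] / x₃)
        - (G ![x₃] - G ![x₁]) / (x₃ * (x₃ - x₁)) + G ![x₁] / (x₁ * x₃))
      = G ![x₁] * (1 / ((x₁ - x₂) * (x₁ - x₃)) - 1 / (x₁ * (x₁ - x₂)) - 1 / (x₁ * (x₁ - x₃)))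
      + G ![x₂] * (1 / ((x₂ - x₁) * (x₂ - x₃)) - 1 / (x₂ * (x₂ - x₁)) - 1 / (x₂ * (x₂ - x₃)))
      + G ![x₃] * (1 / ((x₃ - x₁) * (x₃ - x₂)) - 1 / (x₃ * (x₃ - x₁)) - 1 / (x₃ * (x₃ - x₂))) := by
    rw [← neg_sub x₁ x₂, ← neg_sub x₁ x₃, ← neg_sub x₂ x₃]
    field_simp
    ring
  rw [cyc]
  rw [← neg_sub x₁ x₂, ← neg_sub x₁ x₃, ← neg_sub x₂ x₃] at h ⊢
  -- With the differences oriented alike and taken as atoms, the claim is linear in the values of G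
  -- and needs no relation among p, q, r.
  generalize x₁ - x₂ = p at h ⊢
  generalize x₁ - x₃ = q at h ⊢
  generalize x₂ - x₃ = r at h ⊢
  linear_combination h

end MZV

theorem mainTheorem6 :
    -- all multiple zeta values of depth at most three that occur converge
    (∀ d : ℕ, 1 ≤ d → d ≤ 3 → ∀ s : Fin d → ℕ, MZV.IsAdmissible s →
      Summable (MZV.zetaTerm s)) ∧
    -- all generating series that occur converge absolutely
    (∀ y₁ : ℂ, ‖y₁‖ < 1 → Summable (MZV.genTerm ![y₁])) ∧
    (∀ y₁ y₂ : ℂ, ‖y₁‖ < 2 → ‖y₂‖ < 1 → Summable (MZV.genTerm ![y₁, y₂])) ∧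
    (∀ y₁ y₂ y₃ : ℂ, ‖y₁‖ < 3 → ‖y₂‖ < 2 → ‖y₃‖ < 1 →
      Summable (MZV.genTerm ![y₁, y₂, y₃])) ∧
    (∀ y z : ℂ, ‖y‖ < 1 → ‖z‖ < 1 →
      Summable (fun r : MZV.GeTwoOne =>
        y ^ (r.1.2 - 1) * ((y + z) ^ (r.1.1 - 1) - y ^ (r.1.1 - 1) - z ^ (r.1.1 - 1))
          * (MZV.zeta ![r.1.1, r.1.2, 1] : ℂ)) ∧
      Summable (fun r : MZV.GeTwoOne =>
        y ^ (r.1.1 - 1) * z ^ (r.1.2 - 1) * (MZV.zeta ![r.1.1, 1, r.1.2] : ℂ))) ∧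
    (∀ y : ℂ, ‖y‖ < 1 →
      Summable (fun s : MZV.GeTwo => y ^ (s.1 - 2) * (MZV.zeta ![s.1, 1] : ℂ)) ∧
      Summable (fun s : MZV.GeTwo => y ^ (s.1 - 1) * (MZV.zeta ![s.1, 1] : ℂ)) ∧
      Summable (fun s : MZV.GeTwo => y ^ (s.1 - 1) * (MZV.zeta ![s.1, 2] : ℂ)) ∧
      Summable (fun s : MZV.GeTwo => y ^ (s.1 - 1) * (MZV.zeta ![2, s.1] : ℂ))) ∧
    -- the identity
    ∀ x₁ x₂ x₃ : ℂ, ‖x₁‖ < 1 → ‖x₂‖ < 1 → ‖x₃‖ < 1 →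
      x₁ ≠ 0 → x₂ ≠ 0 → x₃ ≠ 0 → x₁ ≠ x₂ → x₁ ≠ x₃ → x₂ ≠ x₃ →
      MZV.symSum₃ (fun x₁ x₂ x₃ =>
          MZV.G ![x₁ + x₂ + x₃, x₁ + x₂, x₂] - MZV.G ![x₁ + x₂, x₁ + x₂, x₂]
          - MZV.G ![x₂ + x₃, x₂, x₂] + MZV.G ![x₂, x₂, x₂] - MZV.G ![x₁, x₂, x₃]
          - (MZV.G ![x₁, x₃] + MZV.G ![x₃, x₁]) / (x₃ - x₂)
          + MZV.G ![x₁, x₂] / x₂ + MZV.G ![x₂, x₁] / x₂) x₁ x₂ x₃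
      - MZV.cycSum₂ (fun x₂ x₃ =>
          1 / (x₃ - x₂) * ((MZV.G ![x₃] - MZV.G ![x₁]) / (x₃ - x₁) + MZV.G ![x₂] / x₂)
          - (MZV.G ![x₂] - MZV.G ![x₁]) / (x₂ * (x₂ - x₁))
          + MZV.G ![x₁] / (x₁ * x₂)) x₂ x₃
      = MZV.symSum₃ (fun x₁ x₂ x₃ =>
          (∑' r : MZV.GeTwoOne,
            x₁ ^ (r.1.2 - 1)
              * ((x₁ + x₃) ^ (r.1.1 - 1) - x₁ ^ (r.1.1 - 1) - x₃ ^ (r.1.1 - 1))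
              * (MZV.zeta ![r.1.1, r.1.2, 1] : ℂ))
          + (∑' s : MZV.GeTwo, x₁ ^ (s.1 - 2) * (MZV.zeta ![s.1, 1] : ℂ))
          - (∑' r : MZV.GeTwoOne,
              x₁ ^ (r.1.1 - 1) * x₃ ^ (r.1.2 - 1) * (MZV.zeta ![r.1.1, 1, r.1.2] : ℂ))
          + 1 / x₂ * (∑' s : MZV.GeTwo, x₁ ^ (s.1 - 1) * (MZV.zeta ![s.1, 1] : ℂ))
          - (∑' s : MZV.GeTwo,
              x₃ ^ (s.1 - 1) / (x₃ - x₂) * (MZV.zeta ![s.1, 1] : ℂ))) x₁ x₂ x₃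
      + MZV.cycSum₃ (fun x₁ _ _ =>
          (∑' s : MZV.GeTwo, x₁ ^ (s.1 - 1) * (MZV.zeta ![s.1, 2] : ℂ))
          + (∑' s : MZV.GeTwo, x₁ ^ (s.1 - 1) * (MZV.zeta ![2, s.1] : ℂ))
          + MZV.G ![x₁] / x₁ ^ 2 - (MZV.zeta ![2] : ℂ) / x₁) x₁ x₂ x₃
      - (MZV.zeta ![3] : ℂ) := by
  refine ⟨fun d hd _ s hs => ?_, fun y hy => MZV.summable_genTerm_one hy,
    fun y₁ y₂ h₁ h₂ => MZV.summable_genTerm_two h₁ h₂,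
    fun y₁ y₂ y₃ h₁ h₂ h₃ => MZV.summable_genTerm_three h₁ h₂ h₃,
    fun y z hy hz => ⟨(MZV.hasSum_zeta_triple_symm hy hz).summable,
      (MZV.hasSum_zeta_triple_mid (by linarith) hz).summable⟩,
    fun y hy => ⟨MZV.summable_zeta_pair_one_sub_two hy, (MZV.hasSum_zeta_pair_one hy).summable,
      (MZV.hasSum_zeta_pair_two hy).2, (MZV.hasSum_zeta_two_pair hy).2⟩,
    fun x₁ x₂ x₃ h₁ h₂ h₃ z₁ z₂ z₃ h₁₂ h₁₃ h₂₃ => ?_⟩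
  · obtain ⟨n, rfl⟩ := Nat.exists_eq_add_of_le' hd
    exact MZV.summable_zetaTerm hs
  · exact MZV.generating_function_relation h₁ h₂ h₃ z₁ z₂ z₃ h₁₂ h₁₃ h₂₃
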